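/- Let $\mathcal H$ be a separable complex Hilbert space, let $\Phi=(\varphi_1,\ldots,\varphi_k)$ be a $k$-tuple of pairwise commuting $w^*$-continuous completely positive linear maps on $B(\mathcal H)$, and let $\mathbf m=(m_1,\ldots,m_k)$ be a $k$-tuple of positive integers. For a $k$-tuple $\Psi=(\psi_1,\ldots,\psi_k)$ of linear maps on $B(\mathcal K)$, where $\mathcal K$ is a Hilbert space, and $\mathbf p=(p_1,\ldots,p_k)$ with non-negative integer entries, put $$\mathbf\Delta_\Psi^{\mathbf p}:=(\mathrm{id}-\psi_1)^{p_1}\circ\cdots\circ(\mathrm{id}-\psi_k)^{p_k},$$ $$\mathcal C_{\ge}(\mathbf\Delta_\Psi^{\mathbf m})^+:=\{X\in B(\mathcal K): X\ge 0\text{ and }\mathbf\Delta_\Psi^{\mathbf p}(X)\ge 0\text{ for all }\mathbf 0\le\mathbf p\le\mathbf m\},$$ where $\mathbf p\le\mathbf m$ is meant entrywise. Then the following statements are equivalent. (i) There are a Hilbert space $\mathcal G$, a $k$-tuple $\Lambda=(\lambda_1,\ldots,\lambda_k)$ of pairwise commuting $w^*$-continuous positive linear maps on $B(\mathcal G)$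 and an invertible operator $Y\in B(\mathcal G,\mathcal H)$ such that each $\lambda_i$ is pure, that is, $\lambda_i^s(I)\to 0$ in the weak operator topology as $s\to\infty$, such that $I\in\mathcal C_{\ge}(\mathbf\Delta_\Lambda^{\mathbf m})^+$, and such that $\Phi$ is jointly similar to $\Lambda$ via $Y$, that is, $$\varphi_i(YXY^*)=Y\lambda_i(X)Y^*\qquad\text{for all }X\in B(\mathcal G)\text{ and }i\in\{1,\ldots,k\}.$$ (ii) There is an invertible operator $Q\in\mathcal C_{\ge}(\mathbf\Delta_\Phi^{\mathbf m})^+$ such that, for each $i\in\{1,\ldots,k\}$, $\varphi_i^s(Q)\to 0$ in the weak operator topology as $s\to\infty$. (iii) There are constants $0<a\le b$ and a positive operator $R\in B(\mathcal H)$ such that the series below converges in the weak operator topology and $$aI\le\sum_{(s_1,\ldots,s_k)\in\mathbb Z_{\ge 0}^k}\binom{s_1+m_1-1}{m_1-1}\cdots\binom{s_k+m_k-1}{m_k-1}\,\varphi_1^{s_1}\circ\cdots\circ\varphi_k^{s_k}(R)\le bI.$$ -/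

import Mathlib

open Filter Topology
open scoped CStarAlgebra

universe u v

noncomputable section

namespace JointSimilarity

/-- The weak-star (ultraweak) topology on `B(H)`: the coarsest topology for which all functionals
`X ↦ ∑ₙ ⟪yₙ, X xₙ⟫` with `∑ ‖xₙ‖² < ∞` and `∑ ‖yₙ‖² < ∞` are continuous.  These functionals are
exactly the elements of the predual of `B(H)` (the trace class). -/
@[reducible] def weakStarTopology (H : Type u) [NormedAddCommGroup H] [InnerProductSpace ℂ H] :
    TopologicalSpace (H →L[ℂ] H) :=
  ⨅ (x : ℕ → H) (y : ℕ → H) (_ : Summable fun n => ‖x n‖ ^ 2) (_ : Summable fun n => ‖y n‖ ^ 2),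
    TopologicalSpace.induced (fun X : H →L[ℂ] H => ∑' n, inner ℂ (y n) (X (x n))) inferInstance

/-- Continuity of a linear map on `B(H)` for the weak-star topology on both sides. -/
def WeakStarContinuous {H : Type u} [NormedAddCommGroup H] [InnerProductSpace ℂ H]
    (φ : (H →L[ℂ] H) →ₗ[ℂ] (H →L[ℂ] H)) : Prop :=
  @Continuous _ _ (weakStarTopology H) (weakStarTopology H) φ

/-- Convergence to zero of a sequence of operators in the weak operator topology. -/
def WeaklyTendstoZero {H : Type u} [NormedAddCommGroup H] [InnerProductSpace ℂ H]
    (X : ℕ → (H →L[ℂ] H)) : Prop :=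
  Tendsto (fun s => ContinuousLinearMapWOT.ofCLM (X s)) atTop
    (𝓝 (0 : ContinuousLinearMapWOT (RingHom.id ℂ) H H))

/-- The composition `φ₁^{s₁} ∘ ⋯ ∘ φₖ^{sₖ}`. -/
def iterate {H : Type u} [NormedAddCommGroup H] [InnerProductSpace ℂ H] {k : ℕ}
    (Φ : Fin k → Module.End ℂ (H →L[ℂ] H)) (s : Fin k → ℕ) : Module.End ℂ (H →L[ℂ] H) :=
  (List.ofFn fun i => Φ i ^ s i).prod

/-- The defect map `Δ_Φ^p = (id - φ₁)^{p₁} ∘ ⋯ ∘ (id - φₖ)^{pₖ}`. -/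
def defect {H : Type u} [NormedAddCommGroup H] [InnerProductSpace ℂ H] {k : ℕ}
    (Φ : Fin k → Module.End ℂ (H →L[ℂ] H)) (p : Fin k → ℕ) : Module.End ℂ (H →L[ℂ] H) :=
  (List.ofFn fun i => (LinearMap.id - Φ i : Module.End ℂ (H →L[ℂ] H)) ^ p i).prod

/-- The noncommutative cone `C_≥(Δ_Φ^m)⁺`. -/
def cone {H : Type u} [NormedAddCommGroup H] [InnerProductSpace ℂ H] {k : ℕ}
    (Φ : Fin k → Module.End ℂ (H →L[ℂ] H)) (m : Fin k → ℕ) : Set (H →L[ℂ] H) :=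
  {X | 0 ≤ X ∧ ∀ p : Fin k → ℕ, p ≤ m → 0 ≤ defect Φ p X}

/-- `Φ` (on `B(H)`) is jointly similar to `Λ` (on `B(G)`): there is an invertible `R ∈ B(G, H)` with
`φᵢ(R X R*) = R λᵢ(X) R*` for all `i` and all `X ∈ B(G)`. -/
def JointlySimilar {H : Type u} [NormedAddCommGroup H] [InnerProductSpace ℂ H] [CompleteSpace H]
    {G : Type v} [NormedAddCommGroup G] [InnerProductSpace ℂ G] [CompleteSpace G] {k : ℕ}
    (Φ : Fin k → Module.End ℂ (H →L[ℂ] H)) (Λ : Fin k → Module.End ℂ (G →L[ℂ] G)) : Prop :=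
  ∃ R : G ≃L[ℂ] H, ∀ (i : Fin k) (X : G →L[ℂ] G),
    Φ i ((R : G →L[ℂ] H) ∘L X ∘L ContinuousLinearMap.adjoint (R : G →L[ℂ] H)) =
      (R : G →L[ℂ] H) ∘L (Λ i X) ∘L ContinuousLinearMap.adjoint (R : G →L[ℂ] H)

/-- The coefficient `∏ᵢ binom(sᵢ + mᵢ - 1, mᵢ - 1)` (used for `mᵢ ≥ 1`). -/
def binomCoeff {k : ℕ} (m s : Fin k → ℕ) : ℕ :=
  ∏ i, (s i + m i - 1).choose (m i - 1)

/-- The series `∑ₛ ∏ᵢ binom(sᵢ + mᵢ - 1, mᵢ - 1) φ₁^{s₁} ∘ ⋯ ∘ φₖ^{sₖ}(R)`, over all `s ∈ ℕᵏ`,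
converges unconditionally in the weak operator topology, with sum `S`. -/
def HasBinomialSum {H : Type u} [NormedAddCommGroup H] [InnerProductSpace ℂ H] {k : ℕ}
    (Φ : Fin k → Module.End ℂ (H →L[ℂ] H)) (m : Fin k → ℕ) (R S : H →L[ℂ] H) : Prop :=
  HasSum (fun s : Fin k → ℕ =>
      ContinuousLinearMapWOT.ofCLM ((binomCoeff m s : ℂ) • iterate Φ s R))
    (ContinuousLinearMapWOT.ofCLM S)

end JointSimilarity

end

/-!
Positivity turns all questions about operators into questions about the nonnegative numbers
`⟪x, φ^s(A) x⟫`, and the generating function `∏ᵢ (1 - zᵢ)^{-mᵢ}` of the binomial coefficients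
formally inverts the defect map `Δ^m = ∏ᵢ (id - φᵢ)^{mᵢ}`.

* Similarity versus invertible elements of the cone.  A similarity via `Y` intertwines `Φ` and `Λ`
  through `X ↦ Y X Y*`, which preserves positivity, weak limits and defect maps, so `Q = Y Y*`
  has the properties of the identity.  Conversely, for `Q` positive and invertible, write
  `Q = u u*` (with `u` the square root of `Q`) and conjugate `Φ` by `u`.
* From the cone to the series.  For `Q` in the cone and pure, the series of `R = Δ^m Q` sums to
  `Q`.  For a single factor, `∑ₙ φᵢ^n (A - φᵢ A)` telescopes to `A`, for `A = φ^s Δ^p Q`; its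
  remainder is dominated by `φᵢ^n Q` and so vanishes in the limit (`ofReal_re_inner_eq_tsum`).
  Repeating this `mᵢ` times in each direction `i` and collecting equal powers gives the binomial
  coefficients.  As all terms are nonnegative, the rearrangement is done in `ENNReal`
  (`eq_tsum_weight_mul`).
* From the series to the cone.  A weakly convergent series of positive operators has bounded
  partial sums, hence converges in the weak-star topology, and the maps `φᵢ` may be applied termwise
  (`hasSum_map_of_weakStarContinuous`).  Pascal's rule then shows that `Δ^p S` is the series with
  `m - p` in place of `m`, which is positive, and `φᵢ^n S` is dominated by the terms of the series
  with `sᵢ ≥ n`, which tend to zero.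
-/

namespace JointSimilarity

/-! ### Multi-index weights -/



/-- The coefficient `∏ᵢ multichoose (qᵢ) (tᵢ)` of `z ^ t` in `∏ᵢ (1 - zᵢ)^{-qᵢ}`.  It agrees with
`binomCoeff` when all `qᵢ ≥ 1`, and is the indicator of `t = 0` when `q = 0`. -/
def weight {k : ℕ} (q t : Fin k → ℕ) : ℕ :=
  ∏ i, (q i).multichoose (t i)

theorem binomCoeff_eq_weight {k : ℕ} {m : Fin k → ℕ} (hm : ∀ i, 1 ≤ m i) (s : Fin k → ℕ) :
    binomCoeff m s = weight m s := by
  refine Finset.prod_congr rfl fun i _ => ?_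
  have := hm i
  rw [Nat.multichoose_eq, add_comm (m i) (s i)]
  exact Nat.choose_symm_of_eq_add (by omega)

theorem weight_eq_mul {k : ℕ} (q t : Fin k → ℕ) (i : Fin k) :
    weight q t = (q i).multichoose (t i) *
      ∏ j ∈ Finset.univ.erase i, (q j).multichoose (t j) :=
  (Finset.mul_prod_erase _ _ (Finset.mem_univ i)).symm

theorem weight_zero_left {k : ℕ} (t : Fin k → ℕ) : weight 0 t = if t = 0 then 1 else 0 := by
  split_ifs with h
  · subst h
    simp [weight]
  · obtain ⟨i, hi⟩ := Function.ne_iff.1 h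
    refine Finset.prod_eq_zero (Finset.mem_univ i) ?_
    obtain ⟨n, hn⟩ := Nat.exists_eq_succ_of_ne_zero hi
    simp [hn]

/-- Weights at two pairs of multi-indices that agree off the coordinate `i` share the factors
coming from the other coordinates. -/
theorem weight_eq_mul_of_agree {k : ℕ} {q q' t t' : Fin k → ℕ} {i : Fin k}
    (hq : ∀ j, j ≠ i → q j = q' j) (ht : ∀ j, j ≠ i → t j = t' j) :
    weight q t = (q i).multichoose (t i) *
      ∏ j ∈ Finset.univ.erase i, (q' j).multichoose (t' j) := by
  rw [weight_eq_mul q t i]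
  congr 1
  refine Finset.prod_congr rfl fun j hj => ?_
  rw [hq j (Finset.ne_of_mem_erase hj), ht j (Finset.ne_of_mem_erase hj)]

/-- Pascal's rule: comparison of coefficients in `(1 - zᵢ) F' = F`, where `F` and `F'` are the
generating functions of the weights for `q` and for `q + eᵢ`. -/
theorem weight_add_single {k : ℕ} (q w : Fin k → ℕ) (i : Fin k) :
    weight (q + Pi.single i 1) w =
      weight q w + if 1 ≤ w i then weight (q + Pi.single i 1) (w - Pi.single i 1) else 0 := by
  have hq : ∀ j, j ≠ i → (q + Pi.single i 1 : Fin k → ℕ) j = q j := fun j hj => by simp [hj]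
  have hw : ∀ j, j ≠ i → (w - Pi.single i 1 : Fin k → ℕ) j = w j := fun j hj => by simp [hj]
  rw [weight_eq_mul_of_agree hq (fun _ _ => rfl : ∀ j, j ≠ i → w j = w j), weight_eq_mul q w i,
    weight_eq_mul_of_agree hq hw]
  rcases h : w i with _ | n
  · simp
  · simp [h, Nat.multichoose_succ_succ, add_mul]

theorem sum_range_multichoose (n w : ℕ) :
    ∑ u ∈ Finset.range (w + 1), n.multichoose (w - u) = (n + 1).multichoose w := by
  induction w with
  | zero => simp
  | succ w ih => rw [Finset.sum_range_succ', Nat.multichoose_succ_succ, ← ih, add_comm]; simp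

theorem sum_weight_sub_single {k : ℕ} (q w : Fin k → ℕ) (i : Fin k) :
    ∑ u ∈ Finset.range (w i + 1), weight q (w - Pi.single i u) =
      weight (q + Pi.single i 1) w := by
  have hq : ∀ j, j ≠ i → (q + Pi.single i 1 : Fin k → ℕ) j = q j := fun j hj => by simp [hj]
  rw [weight_eq_mul_of_agree hq (fun _ _ => rfl : ∀ j, j ≠ i → w j = w j)]
  have : (q + Pi.single i 1 : Fin k → ℕ) i = q i + 1 := by simp
  rw [this, ← sum_range_multichoose, Finset.sum_mul]
  refine Finset.sum_congr rfl fun u _ => ?_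
  rw [weight_eq_mul_of_agree (fun _ _ => rfl : ∀ j, j ≠ i → q j = q j)
    (t := w - (Pi.single i u : Fin k → ℕ)) (t' := w) (fun j hj => by simp [hj])]
  simp

theorem weight_mono_right {k : ℕ} {q : Fin k → ℕ} (hq : ∀ i, 1 ≤ q i) : Monotone (weight q) := by
  intro s t hst
  refine Finset.prod_le_prod' fun i _ => ?_
  obtain ⟨n, hn⟩ : ∃ n, q i = n + 1 := ⟨q i - 1, by have := hq i; omega⟩
  rw [hn]
  refine monotone_nat_of_le_succ (fun r => ?_) (hst i)
  rw [Nat.multichoose_succ_succ]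
  omega

theorem sub_single_add_single {k : ℕ} {w : Fin k → ℕ} {i : Fin k} {n : ℕ} (h : n ≤ w i) :
    w - Pi.single i n + Pi.single i n = w := by
  funext j
  by_cases hj : j = i
  · subst hj
    simp [h]
  · simp [hj]

theorem multiIndex_induction {k : ℕ} {P : (Fin k → ℕ) → Prop} (zero : P 0)
    (add_single : ∀ p i, P p → P (p + Pi.single i 1)) (p : Fin k → ℕ) : P p := by
  induction h : ∑ i, p i generalizing p with
  | zero =>
    have : p = 0 := funext fun i => (Finset.sum_eq_zero_iff.1 h) i (Finset.mem_univ i)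
    exact this ▸ zero
  | succ n ih =>
    obtain ⟨i, -, hi⟩ : ∃ i ∈ Finset.univ, p i ≠ 0 :=
      Finset.exists_ne_zero_of_sum_ne_zero (by omega)
    have hp := sub_single_add_single (w := p) (i := i) (n := 1) (Nat.one_le_iff_ne_zero.2 hi)
    rw [← hp]
    refine add_single _ _ (ih _ ?_)
    rw [← hp] at h
    simp only [Pi.add_apply, Finset.sum_add_distrib, Finset.sum_pi_single', Finset.mem_univ,
      if_true] at h
    omega

/-- A sum over translates `t + n eᵢ` is a sum over all multi-indices `w` with `n ≤ wᵢ`. -/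
theorem hasSum_add_single_iff {k : ℕ} {M : Type*} [AddCommMonoid M] [TopologicalSpace M]
    (i : Fin k) (n : ℕ) (F : (Fin k → ℕ) → (Fin k → ℕ) → M) (a : M) :
    HasSum (fun t => F t (t + Pi.single i n)) a ↔
      HasSum (fun w => if n ≤ w i then F (w - Pi.single i n) w else 0) a := by
  have hinj : Function.Injective fun t : Fin k → ℕ => t + Pi.single i n :=
    add_left_injective _
  have hcomp : (fun t => F t (t + Pi.single i n)) =
      (fun w => if n ≤ w i then F (w - Pi.single i n) w else 0) ∘ fun t => t + Pi.single i n := by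
    funext t
    simp
  rw [hcomp]
  exact hinj.hasSum_iff fun w hw => if_neg fun h => hw ⟨w - Pi.single i n, sub_single_add_single h⟩

theorem tsum_weight_add_single {k : ℕ} (q : Fin k → ℕ) (i : Fin k)
    (g : (Fin k → ℕ) → ENNReal) :
    ∑' w, (weight (q + Pi.single i 1) w : ENNReal) * g w =
      ∑' t, (weight q t : ENNReal) * ∑' u : ℕ, g (t + Pi.single i u) := by
  simp_rw [← ENNReal.tsum_mul_left]
  rw [ENNReal.tsum_comm]
  have h (u : ℕ) : ∑' t, (weight q t : ENNReal) * g (t + Pi.single i u) =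
      ∑' w, if u ≤ w i then (weight q (w - Pi.single i u) : ENNReal) * g w else 0 :=
    ((hasSum_add_single_iff i u (fun t w => (weight q t : ENNReal) * g w) _).2
      ENNReal.summable.hasSum).tsum_eq
  simp_rw [h]
  rw [ENNReal.tsum_comm]
  refine tsum_congr fun w => ?_
  rw [← sum_weight_sub_single, Nat.cast_sum, Finset.sum_mul,
    tsum_eq_sum (s := Finset.range (w i + 1))]
  · exact Finset.sum_congr rfl fun u hu =>
      (if_pos (Nat.lt_succ_iff.1 (Finset.mem_range.1 hu))).symm
  · intro u hu
    exact if_neg fun h => hu (Finset.mem_range.2 (Nat.lt_succ_iff.2 h))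

/-- If `f p` is obtained from `f (p + eᵢ)` by summing along the `i`-th direction, then `f 0` is
obtained from `f m` by summing against the weights of `∏ᵢ (1 - zᵢ)^{-mᵢ}`. -/
theorem eq_tsum_weight_mul {k : ℕ} {m : Fin k → ℕ} (f : (Fin k → ℕ) → (Fin k → ℕ) → ENNReal)
    (hf : ∀ p i, p + Pi.single i 1 ≤ m → ∀ s,
      f p s = ∑' u : ℕ, f (p + Pi.single i 1) (s + Pi.single i u)) :
    f 0 0 = ∑' t, (weight m t : ENNReal) * f m t := by
  suffices h : ∀ p, p ≤ m → f 0 0 = ∑' t, (weight p t : ENNReal) * f p t from h m le_rfl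
  intro p
  induction p using multiIndex_induction with
  | zero =>
    intro _
    rw [tsum_eq_single 0 fun t ht => by simp [weight_zero_left, ht]]
    simp [weight_zero_left]
  | add_single p i ih =>
    intro hp
    rw [ih (le_trans (le_add_of_nonneg_right (Pi.single_nonneg.2 zero_le_one)) hp),
      tsum_weight_add_single]
    exact tsum_congr fun t => by rw [hf p i hp t]

/-! ### Products of powers of a commuting tuple -/

theorem prod_ofFn_pow_add {M : Type*} [Monoid M] {k : ℕ} {f : Fin k → M}
    (hf : ∀ i j, Commute (f i) (f j)) (s t : Fin k → ℕ) :
    (List.ofFn fun i => f i ^ (s + t) i).prod =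
      (List.ofFn fun i => f i ^ s i).prod * (List.ofFn fun i => f i ^ t i).prod := by
  induction k with
  | zero => simp
  | succ k ih =>
    have hc : Commute (f 0 ^ t 0) (List.ofFn fun i : Fin k => f i.succ ^ s i.succ).prod := by
      refine Commute.list_prod_right _ _ fun x hx => ?_
      obtain ⟨i, rfl⟩ := List.mem_ofFn.1 hx
      exact (hf _ _).pow_pow _ _
    have := ih (f := fun i => f i.succ) (fun i j => hf _ _) (fun i => s i.succ) fun i => t i.succ
    simp only [Pi.add_apply] at this
    simp only [List.ofFn_succ, List.prod_cons, Pi.add_apply]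
    rw [this, pow_add, mul_assoc, ← mul_assoc (f 0 ^ t 0), hc.eq]
    simp only [mul_assoc]

theorem prod_ofFn_pow_zero {M : Type*} [Monoid M] {k : ℕ} (f : Fin k → M) :
    (List.ofFn fun i => f i ^ (0 : Fin k → ℕ) i).prod = 1 := by
  simp

theorem prod_ofFn_pow_single {M : Type*} [Monoid M] {k : ℕ} (f : Fin k → M) (i : Fin k) (n : ℕ) :
    (List.ofFn fun j => f j ^ (Pi.single i n : Fin k → ℕ) j).prod = f i ^ n := by
  induction k with
  | zero => exact i.elim0
  | succ k ih =>
    rw [List.ofFn_succ, List.prod_cons]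
    refine Fin.cases ?_ (fun i => ?_) i
    · simp
    · have := ih (fun j => f j.succ) i
      have h (j : Fin k) : (Pi.single i.succ n : Fin (k + 1) → ℕ) j.succ =
          (Pi.single i n : Fin k → ℕ) j := by
        simp [Pi.single_apply]
      simp only [h, this]
      simp [(Fin.succ_ne_zero i).symm]

/-! ### Weak operator and weak-star convergence -/



section Topology

variable {H : Type u} [NormedAddCommGroup H] [InnerProductSpace ℂ H]

theorem re_inner_apply_nonneg {A : H →L[ℂ] H} (hA : 0 ≤ A) (x : H) :
    0 ≤ (inner ℂ x (A x)).re :=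
  ((ContinuousLinearMap.nonneg_iff_isPositive A).1 hA).re_inner_nonneg_right x

theorem re_inner_apply_mono [CompleteSpace H] {A B : H →L[ℂ] H} (hAB : A ≤ B) (x : H) :
    (inner ℂ x (A x)).re ≤ (inner ℂ x (B x)).re := by
  have := re_inner_apply_nonneg (sub_nonneg.2 hAB) x
  simpa [inner_sub_right] using this

theorem im_inner_apply_eq_zero {A : H →L[ℂ] H} (hA : 0 ≤ A) (x : H) :
    (inner ℂ x (A x)).im = 0 :=
  (Complex.le_def.1
    (((ContinuousLinearMap.nonneg_iff_isPositive A).1 hA).inner_nonneg_right x)).2.symm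

theorem nonneg_of_re_im {A : H →L[ℂ] H} (hre : ∀ x, 0 ≤ (inner ℂ x (A x)).re)
    (him : ∀ x, (inner ℂ x (A x)).im = 0) : 0 ≤ A := by
  rw [ContinuousLinearMap.nonneg_iff_isPositive, ContinuousLinearMap.isPositive_iff_complex]
  intro x
  have hconj : inner ℂ (A x) x = inner ℂ x (A x) := by
    rw [← inner_conj_symm, Complex.conj_eq_iff_im.2 (him x)]
  rw [hconj]
  exact ⟨Complex.ext rfl (by simpa using (him x).symm), hre x⟩

theorem weaklyTendstoZero_iff [CompleteSpace H] {X : ℕ → (H →L[ℂ] H)} :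
    WeaklyTendstoZero X ↔ ∀ x y, Tendsto (fun s => inner ℂ y (X s x)) atTop (𝓝 0) := by
  unfold WeaklyTendstoZero
  rw [ContinuousLinearMapWOT.tendsto_iff_forall_inner_apply_tendsto]
  simp

theorem hasSum_ofCLM_iff [CompleteSpace H] {ι : Type*} {A : ι → (H →L[ℂ] H)} {S : H →L[ℂ] H} :
    HasSum (fun s => ContinuousLinearMapWOT.ofCLM (A s)) (ContinuousLinearMapWOT.ofCLM S) ↔
      ∀ x y, HasSum (fun s => inner ℂ y (A s x)) (inner ℂ y (S x)) := by
  have hsum (F : Finset ι) : ∑ s ∈ F, ContinuousLinearMapWOT.ofCLM (A s) =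
      ContinuousLinearMapWOT.ofCLM (∑ s ∈ F, A s) :=
    (map_sum (ContinuousLinearMapWOT.addEquiv (σ := RingHom.id ℂ) (E := H) (F := H)).symm A F).symm
  simp only [HasSum, SummationFilter.unconditional_filter, hsum,
    ContinuousLinearMapWOT.tendsto_iff_forall_inner_apply_tendsto,
    ContinuousLinearMapWOT.ofCLM_apply, sum_apply, inner_sum]

/-- By polarization, convergence of a series in the weak operator topology only has to be tested
on the diagonal. -/
theorem hasSum_ofCLM_of_diagonal [CompleteSpace H] {ι : Type*} {A : ι → (H →L[ℂ] H)}
    {S : H →L[ℂ] H} (h : ∀ x, HasSum (fun s => inner ℂ x (A s x)) (inner ℂ x (S x))) :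
    HasSum (fun s => ContinuousLinearMapWOT.ofCLM (A s)) (ContinuousLinearMapWOT.ofCLM S) := by
  have h' (x : H) : HasSum (fun s => inner ℂ (A s x) x) (inner ℂ (S x) x) := by
    have := (h x).map (starRingEnd ℂ) Complex.continuous_conj
    simpa [Function.comp_def, inner_conj_symm] using this
  have hpol (x y : H) : HasSum (fun s => inner ℂ (A s x) y) (inner ℂ (S x) y) := by
    have e (B : H →L[ℂ] H) := inner_map_polarization' (B : H →ₗ[ℂ] H) x y
    simp only [ContinuousLinearMap.coe_coe] at e
    simp only [e]
    exact ((((h' _).sub (h' _)).sub ((h' _).mul_left _)).add ((h' _).mul_left _)).div_const _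
  rw [hasSum_ofCLM_iff]
  intro x y
  have := (hpol x y).map (starRingEnd ℂ) Complex.continuous_conj
  simpa [Function.comp_def, inner_conj_symm] using this

theorem tendsto_nhds_weakStar_iff {ι : Type*} {l : Filter ι} {A : ι → (H →L[ℂ] H)}
    {S : H →L[ℂ] H} :
    Tendsto A l (@nhds _ (weakStarTopology H) S) ↔
      ∀ x y : ℕ → H, (Summable fun n => ‖x n‖ ^ 2) → (Summable fun n => ‖y n‖ ^ 2) →
        Tendsto (fun α => ∑' n, inner ℂ (y n) (A α (x n))) l
          (𝓝 (∑' n, inner ℂ (y n) (S (x n)))) := by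
  simp only [nhds_iInf, tendsto_iInf, nhds_induced, tendsto_comap_iff,
    Function.comp_def]

/-- On norm-bounded sets the weak operator topology is finer than the weak-star topology, by
dominated convergence. -/
theorem tendsto_weakStar_of_bounded {ι : Type*} {l : Filter ι} {A : ι → (H →L[ℂ] H)}
    {S : H →L[ℂ] H} {M : ℝ} (hM : ∀ α, ‖A α‖ ≤ M)
    (h : ∀ x y, Tendsto (fun α => inner ℂ y (A α x)) l (𝓝 (inner ℂ y (S x)))) :
    Tendsto A l (@nhds _ (weakStarTopology H) S) := by
  rw [tendsto_nhds_weakStar_iff]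
  intro x y hx hy
  refine tendsto_tsum_of_dominated_convergence
    (bound := fun n => M * (‖x n‖ ^ 2 + ‖y n‖ ^ 2)) ((hx.add hy).mul_left M) (fun n => h _ _) ?_
  refine Eventually.of_forall fun α n => ?_
  have hM0 : 0 ≤ M := (norm_nonneg _).trans (hM α)
  calc ‖inner ℂ (y n) (A α (x n))‖ ≤ ‖y n‖ * ‖A α (x n)‖ := norm_inner_le_norm _ _
    _ ≤ ‖y n‖ * (M * ‖x n‖) := by gcongr; exact (A α).le_of_opNorm_le (hM α) _
    _ = M * (‖x n‖ * ‖y n‖) := by ring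
    _ ≤ M * (‖x n‖ ^ 2 + ‖y n‖ ^ 2) := by
      gcongr
      nlinarith [sq_nonneg (‖x n‖ - ‖y n‖), sq_nonneg ‖x n‖, sq_nonneg ‖y n‖]

/-- A single matrix coefficient is weak-star continuous, being given by sequences supported at one
index. -/
theorem tendsto_inner_of_tendsto_weakStar {ι : Type*} {l : Filter ι} {A : ι → (H →L[ℂ] H)}
    {S : H →L[ℂ] H} (h : Tendsto A l (@nhds _ (weakStarTopology H) S)) (x y : H) :
    Tendsto (fun α => inner ℂ y (A α x)) l (𝓝 (inner ℂ y (S x))) := by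
  have hs (z : H) : Summable fun n => ‖(Pi.single 0 z : ℕ → H) n‖ ^ 2 :=
    summable_of_ne_finset_zero (s := {0}) fun n hn => by
      simp [Pi.single_eq_of_ne (Finset.notMem_singleton.1 hn)]
  have he (B : H →L[ℂ] H) : ∑' n, inner ℂ ((Pi.single 0 y : ℕ → H) n)
      (B ((Pi.single 0 x : ℕ → H) n)) = inner ℂ y (B x) := by
    rw [tsum_eq_single 0 fun n hn => by simp [Pi.single_eq_of_ne hn]]
    simp
  simpa only [he] using tendsto_nhds_weakStar_iff.1 h _ _ (hs x) (hs y)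

/-- Multiplication by fixed operators on both sides is weak-star continuous. -/
theorem continuous_weakStar_conj [CompleteSpace H] (B C : H →L[ℂ] H) :
    @Continuous _ _ (weakStarTopology H) (weakStarTopology H)
      fun X : H →L[ℂ] H => B ∘L X ∘L C := by
  have hs (D : H →L[ℂ] H) {x : ℕ → H} (hx : Summable fun n => ‖x n‖ ^ 2) :
      Summable fun n => ‖D (x n)‖ ^ 2 := by
    refine Summable.of_nonneg_of_le (fun n => by positivity) (fun n => ?_)
      (hx.mul_left (‖D‖ ^ 2))
    rw [← mul_pow]
    exact pow_le_pow_left₀ (norm_nonneg _) (D.le_opNorm _) 2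
  refine @continuous_iff_continuousAt _ _ (weakStarTopology H) (weakStarTopology H) _ |>.2
    fun S => ?_
  refine tendsto_nhds_weakStar_iff.2 fun x y hx hy => ?_
  have := tendsto_nhds_weakStar_iff.1 (@tendsto_id _ (@nhds _ (weakStarTopology H) S))
    (fun n => C (x n)) (fun n => ContinuousLinearMap.adjoint B (y n)) (hs C hx) (hs _ hy)
  simpa [ContinuousLinearMap.adjoint_inner_left] using this

/-- Weak-star continuous linear maps commute with weakly convergent series of positive operators:
the partial sums are bounded, so that the series converges in the weak-star topology as well. -/
theorem hasSum_map_of_weakStarContinuous [CompleteSpace H] {ι : Type*}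
    {φ : (H →L[ℂ] H) →ₗ[ℂ] (H →L[ℂ] H)} (hφ : WeakStarContinuous φ)
    {A : ι → (H →L[ℂ] H)} {S : H →L[ℂ] H} (hA : ∀ s, 0 ≤ A s)
    (h : HasSum (fun s => ContinuousLinearMapWOT.ofCLM (A s)) (ContinuousLinearMapWOT.ofCLM S)) :
    HasSum (fun s => ContinuousLinearMapWOT.ofCLM (φ (A s)))
      (ContinuousLinearMapWOT.ofCLM (φ S)) := by
  rw [hasSum_ofCLM_iff] at h ⊢
  have him (B : H →L[ℂ] H) (hB : 0 ≤ B) := im_inner_apply_eq_zero hB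
  have hle (F : Finset ι) : ∑ s ∈ F, A s ≤ S := by
    rw [← sub_nonneg]
    refine nonneg_of_re_im (fun x => ?_) fun x => ?_
    · have := sum_le_hasSum F (fun s _ => re_inner_apply_nonneg (hA s) x)
        (Complex.hasSum_re (h x x))
      simpa [inner_sub_right, sum_apply, inner_sum] using this
    · have hS := (Complex.hasSum_im (h x x)).unique
        (by simpa only [him _ (hA _)] using hasSum_zero)
      simp [hS, him _ (hA _)]
  have hbdd (F : Finset ι) : ‖∑ s ∈ F, A s‖ ≤ ‖S‖ :=
    CStarAlgebra.norm_le_norm_of_nonneg_of_le (Finset.sum_nonneg fun s _ => hA s) (hle F)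
  have hlim : Tendsto (fun F : Finset ι => ∑ s ∈ F, A s) atTop
      (@nhds _ (weakStarTopology H) S) := by
    refine tendsto_weakStar_of_bounded hbdd fun x y => ?_
    simpa only [HasSum, SummationFilter.unconditional_filter, sum_apply,
      inner_sum] using h x y
  have hlim' : Tendsto (fun F : Finset ι => φ (∑ s ∈ F, A s)) atTop
      (@nhds _ (weakStarTopology H) (φ S)) :=
    Tendsto.comp (@Continuous.tendsto _ _ (weakStarTopology H) (weakStarTopology H) _ hφ S) hlim
  intro x y
  have := tendsto_inner_of_tendsto_weakStar hlim' x y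
  simpa only [HasSum, SummationFilter.unconditional_filter, map_sum,
    sum_apply, inner_sum] using this

end Topology

/-! ### Commuting tuples of maps on operators -/

section Tuples

variable {H : Type u} [NormedAddCommGroup H] [InnerProductSpace ℂ H] {k : ℕ}
  {Φ : Fin k → Module.End ℂ (H →L[ℂ] H)}

theorem iterate_zero (Φ : Fin k → Module.End ℂ (H →L[ℂ] H)) : iterate Φ 0 = 1 :=
  prod_ofFn_pow_zero Φ

theorem iterate_add (hcomm : ∀ i j, Commute (Φ i) (Φ j)) (s t : Fin k → ℕ) :
    iterate Φ (s + t) = iterate Φ s * iterate Φ t :=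
  prod_ofFn_pow_add hcomm s t

theorem iterate_single (Φ : Fin k → Module.End ℂ (H →L[ℂ] H)) (i : Fin k) (n : ℕ) :
    iterate Φ (Pi.single i n) = Φ i ^ n :=
  prod_ofFn_pow_single Φ i n

theorem pow_apply_iterate (hcomm : ∀ i j, Commute (Φ i) (Φ j)) (s : Fin k → ℕ) (i : Fin k) (n : ℕ)
    (X : H →L[ℂ] H) : (Φ i ^ n) (iterate Φ s X) = iterate Φ (s + Pi.single i n) X := by
  rw [add_comm, iterate_add hcomm, iterate_single, Module.End.mul_apply]

theorem iterate_nonneg [CompleteSpace H] (hcomm : ∀ i j, Commute (Φ i) (Φ j))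
    (hpos : ∀ i X, 0 ≤ X → 0 ≤ Φ i X) {X : H →L[ℂ] H} (hX : 0 ≤ X) (s : Fin k → ℕ) :
    0 ≤ iterate Φ s X := by
  induction s using multiIndex_induction with
  | zero => simpa [iterate_zero] using hX
  | add_single s i ih =>
    rw [← pow_apply_iterate hcomm, pow_one]
    exact hpos i _ ih

theorem iterate_mono [CompleteSpace H] (hcomm : ∀ i j, Commute (Φ i) (Φ j))
    (hpos : ∀ i X, 0 ≤ X → 0 ≤ Φ i X) {X Y : H →L[ℂ] H} (hXY : X ≤ Y) (s : Fin k → ℕ) :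
    iterate Φ s X ≤ iterate Φ s Y := by
  rw [← sub_nonneg, ← map_sub]
  exact iterate_nonneg hcomm hpos (sub_nonneg.2 hXY) s

theorem defect_zero (Φ : Fin k → Module.End ℂ (H →L[ℂ] H)) : defect Φ 0 = 1 :=
  prod_ofFn_pow_zero _

theorem defect_add_single (hcomm : ∀ i j, Commute (Φ i) (Φ j)) (p : Fin k → ℕ) (i : Fin k)
    (X : H →L[ℂ] H) : defect Φ (p + Pi.single i 1) X = defect Φ p X - Φ i (defect Φ p X) := by
  have hc (i j) : Commute (LinearMap.id - Φ i : Module.End ℂ (H →L[ℂ] H)) (LinearMap.id - Φ j) :=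
    ((Commute.one_left _).sub_left
      ((Commute.one_right _).sub_right (hcomm i j)) : Commute (1 - Φ i) (1 - Φ j))
  have h₁ : defect Φ (Pi.single i 1 + p) = defect Φ (Pi.single i 1) * defect Φ p :=
    prod_ofFn_pow_add hc _ _
  have h₂ : defect Φ (Pi.single i 1) = (LinearMap.id - Φ i) ^ 1 := prod_ofFn_pow_single _ i 1
  rw [add_comm, h₁, h₂, pow_one]
  rfl

theorem prod_ofFn_comp_of_intertwine {M N : Type*} [AddCommGroup M] [Module ℂ M]
    [AddCommGroup N] [Module ℂ N] {f : Fin k → Module.End ℂ M} {g : Fin k → Module.End ℂ N}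
    {J : N →ₗ[ℂ] M} (h : ∀ i, f i ∘ₗ J = J ∘ₗ g i) :
    (List.ofFn f).prod ∘ₗ J = J ∘ₗ (List.ofFn g).prod := by
  induction k with
  | zero => rfl
  | succ k ih =>
    simp only [List.ofFn_succ, List.prod_cons, Module.End.mul_eq_comp]
    rw [LinearMap.comp_assoc, ih fun i => h i.succ, ← LinearMap.comp_assoc, h 0,
      LinearMap.comp_assoc]

/-- Defect maps are transported by every linear map that intertwines the two tuples. -/
theorem defect_apply_of_intertwine {G : Type v} [NormedAddCommGroup G] [InnerProductSpace ℂ G]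
    {Λ : Fin k → Module.End ℂ (G →L[ℂ] G)} {J : (G →L[ℂ] G) →ₗ[ℂ] (H →L[ℂ] H)}
    (h : ∀ i X, Φ i (J X) = J (Λ i X)) (p : Fin k → ℕ) (X : G →L[ℂ] G) :
    defect Φ p (J X) = J (defect Λ p X) := by
  refine LinearMap.congr_fun (prod_ofFn_comp_of_intertwine fun i =>
    Module.End.commute_pow_left_of_commute (LinearMap.ext fun Y => ?_) (p i)) X
  simp [h]

theorem pow_apply_of_intertwine {G : Type v} [NormedAddCommGroup G] [InnerProductSpace ℂ G]
    {φ : Module.End ℂ (H →L[ℂ] H)}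
    {lam : Module.End ℂ (G →L[ℂ] G)} {J : (G →L[ℂ] G) →ₗ[ℂ] (H →L[ℂ] H)}
    (h : ∀ X, φ (J X) = J (lam X)) (n : ℕ) (X : G →L[ℂ] G) :
    (φ ^ n) (J X) = J ((lam ^ n) X) :=
  LinearMap.congr_fun (Module.End.commute_pow_left_of_commute
    (g₂ := φ) (LinearMap.ext h) n) X

end Tuples

/-! ### Reconstruction of a pure element of the cone from its defect -/

section Reconstruction

variable {H : Type u} [NormedAddCommGroup H] [InnerProductSpace ℂ H] [CompleteSpace H] {k : ℕ}
  {Φ : Fin k → Module.End ℂ (H →L[ℂ] H)} {m : Fin k → ℕ}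

theorem defect_le_of_mem_cone (hcomm : ∀ i j, Commute (Φ i) (Φ j))
    (hpos : ∀ i X, 0 ≤ X → 0 ≤ Φ i X) {Q : H →L[ℂ] H} (hQ : Q ∈ cone Φ m) (p : Fin k → ℕ)
    (hp : p ≤ m) : defect Φ p Q ≤ Q := by
  induction p using multiIndex_induction with
  | zero => simp [defect_zero]
  | add_single p i ih =>
    have hp' : p ≤ m := le_trans (le_add_of_nonneg_right (Pi.single_nonneg.2 zero_le_one)) hp
    rw [defect_add_single hcomm]
    exact (sub_le_self _ (hpos i _ (hQ.2 p hp'))).trans (ih hp')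

theorem iterate_le_of_mem_cone (hcomm : ∀ i j, Commute (Φ i) (Φ j))
    (hpos : ∀ i X, 0 ≤ X → 0 ≤ Φ i X) (hm : ∀ i, 1 ≤ m i) {Q : H →L[ℂ] H} (hQ : Q ∈ cone Φ m)
    (s : Fin k → ℕ) : iterate Φ s Q ≤ Q := by
  induction s using multiIndex_induction with
  | zero => simp [iterate_zero]
  | add_single s i ih =>
    have hi : (0 : Fin k → ℕ) + Pi.single i 1 ≤ m := by
      rw [zero_add]
      intro j
      by_cases hj : j = i
      · subst hj
        simpa using hm j
      · simp [hj]
    have hΦQ : Φ i Q ≤ Q := by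
      have := hQ.2 _ hi
      rwa [defect_add_single hcomm, defect_zero, Module.End.one_apply, sub_nonneg] at this
    rw [iterate_add hcomm, iterate_single, pow_one, Module.End.mul_apply]
    exact (iterate_mono hcomm hpos hΦQ s).trans ih

/-- The telescoping series `∑ᵤ φᵢ^u (A - φᵢ A) = A`, evaluated on a vector, for `A = φ^s Δ^p Q`.
Its remainder is dominated by `φᵢ^n Q`, which tends to zero. -/
theorem ofReal_re_inner_eq_tsum (hcomm : ∀ i j, Commute (Φ i) (Φ j))
    (hpos : ∀ i X, 0 ≤ X → 0 ≤ Φ i X) (hm : ∀ i, 1 ≤ m i) {Q : H →L[ℂ] H} (hQ : Q ∈ cone Φ m)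
    (hpure : ∀ i, WeaklyTendstoZero fun n => (Φ i ^ n) Q) (x : H) (p : Fin k → ℕ) (i : Fin k)
    (hp : p + Pi.single i 1 ≤ m) (s : Fin k → ℕ) :
    ENNReal.ofReal (inner ℂ x (iterate Φ s (defect Φ p Q) x)).re =
      ∑' u : ℕ, ENNReal.ofReal
        (inner ℂ x (iterate Φ (s + Pi.single i u) (defect Φ (p + Pi.single i 1) Q) x)).re := by
  have hp' : p ≤ m := le_trans (le_add_of_nonneg_right (Pi.single_nonneg.2 zero_le_one)) hp
  set a : ℕ → ℝ := fun u => (inner ℂ x (iterate Φ (s + Pi.single i u) (defect Φ p Q) x)).re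
    with ha
  have hdiff (u : ℕ) : (inner ℂ x (iterate Φ (s + Pi.single i u)
      (defect Φ (p + Pi.single i 1) Q) x)).re = a u - a (u + 1) := by
    have : iterate Φ (s + Pi.single i u) (Φ i (defect Φ p Q)) =
        iterate Φ (s + Pi.single i (u + 1)) (defect Φ p Q) := by
      rw [Pi.single_add, ← add_assoc, iterate_add hcomm _ (Pi.single i 1), iterate_single,
        pow_one, Module.End.mul_apply]
    rw [defect_add_single hcomm, map_sub, this]
    simp [ha]
  have hnonneg (u : ℕ) : 0 ≤ (inner ℂ x (iterate Φ (s + Pi.single i u)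
      (defect Φ (p + Pi.single i 1) Q) x)).re :=
    re_inner_apply_nonneg (iterate_nonneg hcomm hpos (hQ.2 _ hp) _) x
  have hlim : Tendsto a atTop (𝓝 0) := by
    have h0 := (Complex.continuous_re.tendsto 0).comp (weaklyTendstoZero_iff.1 (hpure i) x x)
    refine squeeze_zero (fun u => ?_) (fun u => ?_) h0
    · exact re_inner_apply_nonneg (iterate_nonneg hcomm hpos (hQ.2 _ hp') _) x
    · refine re_inner_apply_mono ?_ x
      -- `φ^(s + u eᵢ) Δ^p Q = φᵢ^u (φ^s Δ^p Q)`, and `φ^s Δ^p Q ≤ φ^s Q ≤ Q`.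
      rw [add_comm s, iterate_add hcomm, iterate_single, Module.End.mul_apply, ← iterate_single]
      refine iterate_mono hcomm hpos ?_ _
      exact (iterate_mono hcomm hpos (defect_le_of_mem_cone hcomm hpos hQ p hp') s).trans
        (iterate_le_of_mem_cone hcomm hpos hm hQ s)
  have hsum : HasSum (fun u => (inner ℂ x (iterate Φ (s + Pi.single i u)
      (defect Φ (p + Pi.single i 1) Q) x)).re) (a 0) := by
    rw [hasSum_iff_tendsto_nat_of_nonneg hnonneg]
    simp only [hdiff, Finset.sum_range_sub']
    simpa using hlim.const_sub (a 0)
  rw [← ENNReal.ofReal_tsum_of_nonneg hnonneg hsum.summable, hsum.tsum_eq]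
  simp [ha]

theorem hasSum_of_tsum_ofReal_eq {ι : Type*} {a : ι → ℝ} {b : ℝ} (ha : ∀ s, 0 ≤ a s) (hb : 0 ≤ b)
    (h : ∑' s, ENNReal.ofReal (a s) = ENNReal.ofReal b) : HasSum a b := by
  have hsum : Summable a := by
    have := ENNReal.summable_toReal (f := fun s => ENNReal.ofReal (a s)) (by simp [h])
    simpa only [ENNReal.toReal_ofReal (ha _)] using this
  rw [← ENNReal.ofReal_tsum_of_nonneg ha hsum,
    ENNReal.ofReal_eq_ofReal_iff (tsum_nonneg ha) hb] at h
  exact h ▸ hsum.hasSum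

/-- A pure element of the cone is the binomial series of its own defect. -/
theorem hasBinomialSum_defect (hcomm : ∀ i j, Commute (Φ i) (Φ j))
    (hpos : ∀ i X, 0 ≤ X → 0 ≤ Φ i X) (hm : ∀ i, 1 ≤ m i) {Q : H →L[ℂ] H} (hQ : Q ∈ cone Φ m)
    (hpure : ∀ i, WeaklyTendstoZero fun n => (Φ i ^ n) Q) :
    HasBinomialSum Φ m (defect Φ m Q) Q := by
  refine hasSum_ofCLM_of_diagonal fun x => ?_
  have hD (s) : 0 ≤ iterate Φ s (defect Φ m Q) :=
    iterate_nonneg hcomm hpos (hQ.2 m le_rfl) s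
  have key := eq_tsum_weight_mul (m := m)
    (fun p s => ENNReal.ofReal (inner ℂ x (iterate Φ s (defect Φ p Q) x)).re)
    (ofReal_re_inner_eq_tsum hcomm hpos hm hQ hpure x)
  have hsum : HasSum (fun s => (weight m s : ℝ) *
      (inner ℂ x (iterate Φ s (defect Φ m Q) x)).re) (inner ℂ x (Q x)).re := by
    refine hasSum_of_tsum_ofReal_eq
      (fun s => mul_nonneg (Nat.cast_nonneg _) (re_inner_apply_nonneg (hD s) x))
      (re_inner_apply_nonneg hQ.1 x) ?_
    simp only [ENNReal.ofReal_mul (Nat.cast_nonneg _), ENNReal.ofReal_natCast, ← key]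
    simp [iterate_zero, defect_zero]
  rw [Complex.hasSum_iff]
  constructor
  · simpa [binomCoeff_eq_weight hm, inner_smul_right] using hsum
  · simp [im_inner_apply_eq_zero (hD _), im_inner_apply_eq_zero hQ.1]

end Reconstruction

/-! ### Sums of binomial series -/

section BinomialSums

variable {H : Type u} [NormedAddCommGroup H] [InnerProductSpace ℂ H] [CompleteSpace H] {k : ℕ}
  {Φ : Fin k → Module.End ℂ (H →L[ℂ] H)} {m : Fin k → ℕ} {R S : H →L[ℂ] H}

theorem nonneg_of_hasSum_ofCLM {ι : Type*} {A : ι → (H →L[ℂ] H)} (hA : ∀ s, 0 ≤ A s)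
    (h : HasSum (fun s => ContinuousLinearMapWOT.ofCLM (A s)) (ContinuousLinearMapWOT.ofCLM S)) :
    0 ≤ S := by
  rw [hasSum_ofCLM_iff] at h
  refine nonneg_of_re_im (fun x => ?_) fun x => ?_
  · exact (Complex.hasSum_re (h x x)).nonneg fun s => re_inner_apply_nonneg (hA s) x
  · refine (Complex.hasSum_im (h x x)).unique ?_
    simpa only [im_inner_apply_eq_zero (hA _)] using hasSum_zero

theorem weight_smul_iterate_nonneg (hcomm : ∀ i j, Commute (Φ i) (Φ j))
    (hpos : ∀ i X, 0 ≤ X → 0 ≤ Φ i X) (hR : 0 ≤ R) (q s : Fin k → ℕ) :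
    0 ≤ (weight q s : ℂ) • iterate Φ s R := by
  rw [Nat.cast_smul_eq_nsmul]
  exact nsmul_nonneg (iterate_nonneg hcomm hpos hR s) _

/-- Applying `φᵢ^n` to a weighted series termwise, by normality, and reindexing. -/
theorem hasSum_pow_apply (hcont : ∀ i, WeakStarContinuous (Φ i))
    (hcomm : ∀ i j, Commute (Φ i) (Φ j)) (hpos : ∀ i X, 0 ≤ X → 0 ≤ Φ i X) (hR : 0 ≤ R)
    {q : Fin k → ℕ} {D : H →L[ℂ] H}
    (h : HasSum (fun s => ContinuousLinearMapWOT.ofCLM ((weight q s : ℂ) • iterate Φ s R))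
      (ContinuousLinearMapWOT.ofCLM D)) (i : Fin k) (n : ℕ) :
    HasSum (fun w => if n ≤ w i then ContinuousLinearMapWOT.ofCLM
        ((weight q (w - Pi.single i n) : ℂ) • iterate Φ w R) else 0)
      (ContinuousLinearMapWOT.ofCLM ((Φ i ^ n) D)) := by
  have hcont' : WeakStarContinuous (Φ i ^ n) := by
    have : ⇑(Φ i ^ n) = (Φ i)^[n] := funext (Module.End.pow_apply (Φ i) n)
    unfold WeakStarContinuous
    rw [this]
    exact @Continuous.iterate _ (weakStarTopology H) _ (hcont i) n
  have h' := hasSum_map_of_weakStarContinuous hcont'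
    (weight_smul_iterate_nonneg hcomm hpos hR q) h
  simp only [map_smul, pow_apply_iterate hcomm] at h'
  exact (hasSum_add_single_iff i n (fun t w => ContinuousLinearMapWOT.ofCLM
    ((weight q t : ℂ) • iterate Φ w R)) _).1 h'

/-- Applying `id - φᵢ` lowers the weight of a series by one in the `i`-th direction. -/
theorem hasSum_weight_sub_apply (hcont : ∀ i, WeakStarContinuous (Φ i))
    (hcomm : ∀ i j, Commute (Φ i) (Φ j)) (hpos : ∀ i X, 0 ≤ X → 0 ≤ Φ i X) (hR : 0 ≤ R)
    {q : Fin k → ℕ} {i : Fin k} {D : H →L[ℂ] H}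
    (h : HasSum (fun s => ContinuousLinearMapWOT.ofCLM
      ((weight (q + Pi.single i 1) s : ℂ) • iterate Φ s R)) (ContinuousLinearMapWOT.ofCLM D)) :
    HasSum (fun s => ContinuousLinearMapWOT.ofCLM ((weight q s : ℂ) • iterate Φ s R))
      (ContinuousLinearMapWOT.ofCLM (D - Φ i D)) := by
  have h' := h.sub (hasSum_pow_apply hcont hcomm hpos hR h i 1)
  rw [pow_one] at h'
  have e : (fun s => ContinuousLinearMapWOT.ofCLM ((weight q s : ℂ) • iterate Φ s R)) =
      fun w => ContinuousLinearMapWOT.ofCLM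
        ((weight (q + Pi.single i 1) w : ℂ) • iterate Φ w R) - if 1 ≤ w i then
          ContinuousLinearMapWOT.ofCLM
            ((weight (q + Pi.single i 1) (w - Pi.single i 1) : ℂ) • iterate Φ w R) else 0 := by
    funext w
    rw [weight_add_single q w i]
    split_ifs with hw
    · rw [← ContinuousLinearMapWOT.ofCLM_sub, ← sub_smul]
      congr 2
      push_cast
      ring
    · simp
  rw [e]
  exact h'

/-- For `p ≤ m`, the operator `Δ^p S` is the binomial series with `m - p` in place of `m`, hence
positive. -/
theorem mem_cone_of_hasBinomialSum (hcont : ∀ i, WeakStarContinuous (Φ i))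
    (hcomm : ∀ i j, Commute (Φ i) (Φ j)) (hpos : ∀ i X, 0 ≤ X → 0 ≤ Φ i X) (hm : ∀ i, 1 ≤ m i)
    (hR : 0 ≤ R) (h : HasBinomialSum Φ m R S) : S ∈ cone Φ m := by
  have key (p : Fin k → ℕ) (hp : p ≤ m) :
      HasSum (fun s => ContinuousLinearMapWOT.ofCLM ((weight (m - p) s : ℂ) • iterate Φ s R))
        (ContinuousLinearMapWOT.ofCLM (defect Φ p S)) := by
    induction p using multiIndex_induction with
    | zero => simpa [HasBinomialSum, binomCoeff_eq_weight hm, defect_zero] using h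
    | add_single p i ih =>
      have hp' : p ≤ m := le_trans (le_add_of_nonneg_right (Pi.single_nonneg.2 zero_le_one)) hp
      have hsub : m - p = m - (p + Pi.single i 1) + Pi.single i 1 := by
        rw [← tsub_tsub]
        refine (sub_single_add_single ?_).symm
        have := hp i
        simp only [Pi.add_apply, Pi.single_eq_same] at this
        simp only [Pi.sub_apply]
        omega
      have ih' := ih hp'
      rw [hsub] at ih'
      rw [defect_add_single hcomm]
      exact hasSum_weight_sub_apply hcont hcomm hpos hR ih'
  have hdef (p : Fin k → ℕ) (hp : p ≤ m) : 0 ≤ defect Φ p S :=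
    nonneg_of_hasSum_ofCLM (weight_smul_iterate_nonneg hcomm hpos hR _) (key p hp)
  exact ⟨by simpa [defect_zero] using hdef 0 (fun _ => Nat.zero_le _), hdef⟩

/-- The sum of a binomial series is pure: up to smaller coefficients, `φᵢ^n S` is the part of the
series with `sᵢ ≥ n`. -/
theorem weaklyTendstoZero_of_hasBinomialSum (hcont : ∀ i, WeakStarContinuous (Φ i))
    (hcomm : ∀ i j, Commute (Φ i) (Φ j)) (hpos : ∀ i X, 0 ≤ X → 0 ≤ Φ i X) (hm : ∀ i, 1 ≤ m i)
    (hR : 0 ≤ R) (h : HasBinomialSum Φ m R S) (i : Fin k) :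
    WeaklyTendstoZero fun n => (Φ i ^ n) S := by
  simp only [HasBinomialSum, binomCoeff_eq_weight hm] at h
  rw [weaklyTendstoZero_iff]
  intro x y
  have hsum := (hasSum_ofCLM_iff.1 h x y).summable.norm
  have hn (n : ℕ) : inner ℂ y ((Φ i ^ n) S x) = ∑' w : Fin k → ℕ, if n ≤ w i then
      (weight m (w - Pi.single i n) : ℂ) * inner ℂ y (iterate Φ w R x) else 0 := by
    have hn' := hasSum_pow_apply hcont hcomm hpos hR h i n
    have e (w : Fin k → ℕ) : (if n ≤ w i then ContinuousLinearMapWOT.ofCLM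
        ((weight m (w - Pi.single i n) : ℂ) • iterate Φ w R) else 0) =
        ContinuousLinearMapWOT.ofCLM (if n ≤ w i then
          (weight m (w - Pi.single i n) : ℂ) • iterate Φ w R else 0) := by
      split_ifs <;> rfl
    simp only [e] at hn'
    rw [← (hasSum_ofCLM_iff.1 hn' x y).tsum_eq]
    refine tsum_congr fun w => ?_
    split_ifs <;> simp
  simp only [hn]
  have := tendsto_tsum_of_dominated_convergence (𝓕 := atTop) (g := fun _ => (0 : ℂ)) hsum
    (f := fun n w => if n ≤ w i then
      (weight m (w - Pi.single i n) : ℂ) * inner ℂ y (iterate Φ w R x) else 0)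
    (fun w => ?_) (.of_forall fun n w => ?_)
  · simpa using this
  · refine tendsto_const_nhds.congr' ?_
    filter_upwards [eventually_gt_atTop (w i)] with n hw
    exact (if_neg (not_le.2 hw)).symm
  · split_ifs
    · have hle : (weight m (w - Pi.single i n) : ℝ) ≤ weight m w :=
        Nat.cast_le.2 (weight_mono_right hm tsub_le_self)
      simp only [smul_apply, inner_smul_right, norm_mul, Complex.norm_natCast]
      gcongr
    · simpa only [norm_zero] using norm_nonneg _

end BinomialSums

/-! ### Conjugation by an operator -/

section Conjugation

variable {H : Type u} [NormedAddCommGroup H] [InnerProductSpace ℂ H] [CompleteSpace H]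
  {G : Type v} [NormedAddCommGroup G] [InnerProductSpace ℂ G] [CompleteSpace G]

/-- The linear map `X ↦ T X T*` from `B(G)` to `B(H)` given by an operator `T : G → H`. -/
noncomputable def conj (T : G →L[ℂ] H) : (G →L[ℂ] G) →ₗ[ℂ] (H →L[ℂ] H) where
  toFun X := T ∘L X ∘L ContinuousLinearMap.adjoint T
  map_add' X Y := by ext; simp
  map_smul' c X := by ext; simp

theorem conj_apply (T : G →L[ℂ] H) (X : G →L[ℂ] G) :
    conj T X = T ∘L X ∘L ContinuousLinearMap.adjoint T :=
  rfl

theorem conj_nonneg (T : G →L[ℂ] H) {X : G →L[ℂ] G} (hX : 0 ≤ X) : 0 ≤ conj T X := by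
  rw [ContinuousLinearMap.nonneg_iff_isPositive] at hX ⊢
  exact hX.conj_adjoint T

theorem conj_conj (T U : H →L[ℂ] H) (X : H →L[ℂ] H) : conj T (conj U X) = conj (T * U) X := by
  simp only [conj_apply, ← ContinuousLinearMap.star_eq_adjoint, star_mul,
    ← ContinuousLinearMap.mul_def, mul_assoc]

theorem conj_one_left (X : H →L[ℂ] H) : conj (1 : H →L[ℂ] H) X = X := by
  simp only [conj_apply, ← ContinuousLinearMap.star_eq_adjoint, star_one,
    ← ContinuousLinearMap.mul_def, mul_one, one_mul]

theorem isUnit_conj_one (Y : G ≃L[ℂ] H) : IsUnit (conj (Y : G →L[ℂ] H) 1) := by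
  have hadj : ContinuousLinearMap.adjoint (Y.symm : H →L[ℂ] G) ∘L
      ContinuousLinearMap.adjoint (Y : G →L[ℂ] H) = 1 := by
    rw [← ContinuousLinearMap.adjoint_comp, Y.coe_comp_coe_symm]
    exact ContinuousLinearMap.adjoint_id
  have hadj' : ContinuousLinearMap.adjoint (Y : G →L[ℂ] H) ∘L
      ContinuousLinearMap.adjoint (Y.symm : H →L[ℂ] G) = 1 := by
    rw [← ContinuousLinearMap.adjoint_comp, Y.coe_symm_comp_coe]
    exact ContinuousLinearMap.adjoint_id
  rw [isUnit_iff_exists]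
  refine ⟨ContinuousLinearMap.adjoint (Y.symm : H →L[ℂ] G) ∘L (Y.symm : H →L[ℂ] G), ?_, ?_⟩
  · ext x
    have := DFunLike.congr_fun hadj' (Y.symm x)
    rw [ContinuousLinearMap.comp_apply, one_apply_eq_self] at this
    simp [conj_apply, this]
  · ext x
    have := DFunLike.congr_fun hadj x
    simpa [conj_apply] using this

theorem weaklyTendstoZero_conj (T : G →L[ℂ] H) {X : ℕ → (G →L[ℂ] G)} (hX : WeaklyTendstoZero X) :
    WeaklyTendstoZero fun s => conj T (X s) := by
  rw [weaklyTendstoZero_iff] at hX ⊢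
  intro x y
  simpa [conj_apply, ContinuousLinearMap.adjoint_inner_left] using
    hX (ContinuousLinearMap.adjoint T x) (ContinuousLinearMap.adjoint T y)

/-- A positive invertible operator is of the form `u u*` with `u` invertible. -/
theorem exists_units_conj_one_eq {Q : H →L[ℂ] H} (hQ : 0 ≤ Q) (hu : IsUnit Q) :
    ∃ u : (H →L[ℂ] H)ˣ, conj (u : H →L[ℂ] H) 1 = Q := by
  obtain ⟨u, hu'⟩ := (CFC.isUnit_sqrt_iff Q hQ).2 hu
  refine ⟨u, ?_⟩
  rw [hu', conj_apply, ← ContinuousLinearMap.star_eq_adjoint,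
    (IsSelfAdjoint.of_nonneg (CFC.sqrt_nonneg Q)).star_eq, ← ContinuousLinearMap.mul_def,
    ← ContinuousLinearMap.mul_def, one_mul, CFC.sqrt_mul_sqrt_self Q hQ]

end Conjugation

/-! ### Similarity, invertible elements of the cone and binomial series -/

section Equivalence

variable {H : Type u} [NormedAddCommGroup H] [InnerProductSpace ℂ H] [CompleteSpace H] {k : ℕ}
  {Φ : Fin k → Module.End ℂ (H →L[ℂ] H)} {m : Fin k → ℕ}

/-- If `Φ` is similar to `Λ` via `Y`, then `Y Y*` inherits the properties of the identity. -/
theorem exists_isUnit_mem_cone_of_jointlySimilar {G : Type v} [NormedAddCommGroup G]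
    [InnerProductSpace ℂ G] [CompleteSpace G] {Λ : Fin k → Module.End ℂ (G →L[ℂ] G)}
    (hpure : ∀ i, WeaklyTendstoZero fun s => (Λ i ^ s) 1) (hcone : 1 ∈ cone Λ m)
    (hsim : JointlySimilar Φ Λ) :
    ∃ Q ∈ cone Φ m, IsUnit Q ∧ ∀ i, WeaklyTendstoZero fun s => (Φ i ^ s) Q := by
  obtain ⟨Y, hY⟩ := hsim
  have hint (i) (X : G →L[ℂ] G) : Φ i (conj Y X) = conj Y (Λ i X) := hY i X
  refine ⟨conj Y 1, ⟨conj_nonneg _ hcone.1, fun p hp => ?_⟩, isUnit_conj_one Y, fun i => ?_⟩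
  · rw [defect_apply_of_intertwine hint]
    exact conj_nonneg _ (hcone.2 p hp)
  · simp only [pow_apply_of_intertwine (hint i)]
    exact weaklyTendstoZero_conj _ (hpure i)

/-- Conjugating `Φ` by an invertible `u` with `u u* = Q` moves the properties of `Q` to the
identity. -/
theorem exists_jointlySimilar_of_isUnit_mem_cone (hcont : ∀ i, WeakStarContinuous (Φ i))
    (hcomm : ∀ i j, Commute (Φ i) (Φ j)) (hpos : ∀ i X, 0 ≤ X → 0 ≤ Φ i X)
    {Q : H →L[ℂ] H} (hQ : Q ∈ cone Φ m) (hunit : IsUnit Q)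
    (hpure : ∀ i, WeaklyTendstoZero fun n => (Φ i ^ n) Q) :
    ∃ Λ : Fin k → ((H →L[ℂ] H) →ₚ[ℂ] (H →L[ℂ] H)),
      (∀ i j, ∀ X : H →L[ℂ] H, Λ i (Λ j X) = Λ j (Λ i X)) ∧
      (∀ i, WeakStarContinuous (Λ i).toLinearMap) ∧
      (∀ i, WeaklyTendstoZero (fun s => ((Λ i)^[s]) (1 : H →L[ℂ] H))) ∧
      (1 : H →L[ℂ] H) ∈ cone (fun i => (Λ i).toLinearMap) m ∧
      JointlySimilar Φ (fun i => (Λ i).toLinearMap) := by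
  obtain ⟨u, rfl⟩ := exists_units_conj_one_eq hQ.1 hunit
  set T : H →L[ℂ] H := ↑u with hT
  set V : H →L[ℂ] H := ↑u⁻¹ with hV
  have hTV (X : H →L[ℂ] H) : conj T (conj V X) = X := by
    rw [conj_conj, u.mul_inv, conj_one_left]
  have hVT (X : H →L[ℂ] H) : conj V (conj T X) = X := by
    rw [conj_conj, u.inv_mul, conj_one_left]
  let Λ : Fin k → ((H →L[ℂ] H) →ₚ[ℂ] (H →L[ℂ] H)) := fun i =>
    PositiveLinearMap.mk₀ (conj V ∘ₗ Φ i ∘ₗ conj T)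
      fun X hX => conj_nonneg V (hpos i _ (conj_nonneg T hX))
  have hΛ (i) (X : H →L[ℂ] H) : Λ i X = conj V (Φ i (conj T X)) := rfl
  have hint (i) (X : H →L[ℂ] H) : (Λ i).toLinearMap (conj V X) = conj V (Φ i X) := by
    change conj V (Φ i (conj T (conj V X))) = _
    rw [hTV]
  have hone : (1 : H →L[ℂ] H) = conj V (conj T 1) := (hVT 1).symm
  refine ⟨Λ, fun i j X => ?_, fun i => ?_, fun i => ?_, ⟨zero_le_one, fun p hp => ?_⟩,
    ContinuousLinearEquiv.ofUnit u, fun i X => ?_⟩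
  · simp only [hΛ, hTV]
    exact congrArg (conj V) (LinearMap.congr_fun (hcomm i j) (conj T X))
  · have hV' := continuous_weakStar_conj V (ContinuousLinearMap.adjoint V)
    have hT' := continuous_weakStar_conj T (ContinuousLinearMap.adjoint T)
    let := weakStarTopology H
    exact Continuous.comp (f := fun X => Φ i (conj T X)) hV' (Continuous.comp (hcont i) hT')
  · have hpow (s : ℕ) : ((Λ i)^[s]) (1 : H →L[ℂ] H) = conj V ((Φ i ^ s) (conj T 1)) := by
      rw [← pow_apply_of_intertwine (hint i), ← hone, Module.End.pow_apply]
      rfl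
    simp only [hpow]
    exact weaklyTendstoZero_conj V (hpure i)
  · rw [hone, defect_apply_of_intertwine hint]
    exact conj_nonneg V (hQ.2 p hp)
  · change Φ i (conj T X) = conj T (Λ i X)
    rw [hΛ, hTV]

theorem exists_pos_smul_one_le {Q : H →L[ℂ] H} (hQ : 0 ≤ Q) (hunit : IsUnit Q) :
    ∃ a : ℝ, 0 < a ∧ (a : ℂ) • (1 : H →L[ℂ] H) ≤ Q := by
  rcases subsingleton_or_nontrivial (H →L[ℂ] H) with hs | hn
  · exact ⟨1, one_pos, (Subsingleton.elim _ _).le⟩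
  · obtain ⟨r, hr, hle⟩ := (CFC.exists_pos_algebraMap_le_iff (IsSelfAdjoint.of_nonneg hQ)).2
      fun x hx => (hunit.isStrictlyPositive hQ).spectrum_pos hx
    refine ⟨r, hr, ?_⟩
    rwa [Complex.coe_smul, ← Algebra.algebraMap_eq_smul_one]

theorem le_norm_smul_one {Q : H →L[ℂ] H} (hQ : 0 ≤ Q) :
    Q ≤ ((‖Q‖ : ℝ) : ℂ) • (1 : H →L[ℂ] H) := by
  rw [Complex.coe_smul, ← Algebra.algebraMap_eq_smul_one]
  exact (IsSelfAdjoint.of_nonneg hQ).le_algebraMap_norm_self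

theorem isUnit_of_smul_one_le {a : ℝ} (ha : 0 < a) {S : H →L[ℂ] H}
    (h : (a : ℂ) • (1 : H →L[ℂ] H) ≤ S) : IsUnit S := by
  rw [Complex.coe_smul] at h
  exact CStarAlgebra.isUnit_of_le _ h (isStrictlyPositive_one.smul ha)

end Equivalence

end JointSimilarity

theorem mainTheorem8 {H : Type u} [NormedAddCommGroup H] [InnerProductSpace ℂ H]
    [CompleteSpace H] [TopologicalSpace.SeparableSpace H] {k : ℕ}
    (Φ : Fin k → ((H →L[ℂ] H) →CP (H →L[ℂ] H)))
    (hΦcont : ∀ i, JointSimilarity.WeakStarContinuous (Φ i).toLinearMap)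
    (hΦcomm : ∀ i j, ∀ X : H →L[ℂ] H, Φ i (Φ j X) = Φ j (Φ i X))
    (m : Fin k → ℕ) (hm : ∀ i, 1 ≤ m i) :
    List.TFAE
      [ -- (i) similarity to a pure tuple having the identity in its cone
        ∃ (G : Type u) (_ : NormedAddCommGroup G) (_ : InnerProductSpace ℂ G)
          (_ : CompleteSpace G) (Λ : Fin k → ((G →L[ℂ] G) →ₚ[ℂ] (G →L[ℂ] G))),
          (∀ i j, ∀ X : G →L[ℂ] G, Λ i (Λ j X) = Λ j (Λ i X)) ∧
          (∀ i, JointSimilarity.WeakStarContinuous (Λ i).toLinearMap) ∧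
          (∀ i, JointSimilarity.WeaklyTendstoZero
            (fun s => ((Λ i)^[s]) (1 : G →L[ℂ] G))) ∧
          (1 : G →L[ℂ] G) ∈ JointSimilarity.cone (fun i => (Λ i).toLinearMap) m ∧
          JointSimilarity.JointlySimilar (fun i => (Φ i).toLinearMap)
            (fun i => (Λ i).toLinearMap),
        -- (ii) an invertible pure element of the cone
        ∃ Q ∈ JointSimilarity.cone (fun i => (Φ i).toLinearMap) m,
          IsUnit Q ∧
          ∀ i, JointSimilarity.WeaklyTendstoZero (fun s => ((Φ i)^[s]) Q),
        -- (iii) two-sided bounds for the binomial series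
        ∃ (a b : ℝ) (R S : H →L[ℂ] H), 0 < a ∧ a ≤ b ∧ 0 ≤ R ∧
          JointSimilarity.HasBinomialSum (fun i => (Φ i).toLinearMap) m R S ∧
          (a : ℂ) • (1 : H →L[ℂ] H) ≤ S ∧ S ≤ (b : ℂ) • (1 : H →L[ℂ] H) ] := by
  have hcomm (i j) : Commute (Φ i).toLinearMap (Φ j).toLinearMap :=
    LinearMap.ext fun X => hΦcomm i j X
  have hpos (i) (X : H →L[ℂ] H) (hX : 0 ≤ X) : 0 ≤ (Φ i).toLinearMap X :=
    map_nonneg (Φ i) hX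
  have hpow (i) (s : ℕ) (X : H →L[ℂ] H) : ((Φ i)^[s]) X = ((Φ i).toLinearMap ^ s) X :=
    (Module.End.pow_apply (Φ i).toLinearMap s X).symm
  simp only [hpow]
  tfae_have 1 → 2 := by
    rintro ⟨G, _, _, _, Λ, -, -, hpure, hcone, hsim⟩
    refine JointSimilarity.exists_isUnit_mem_cone_of_jointlySimilar (fun i => ?_) hcone hsim
    simp only [Module.End.pow_apply]
    exact hpure i
  tfae_have 2 → 1 := by
    rintro ⟨Q, hQ, hunit, hpure⟩
    exact ⟨H, _, _, _, JointSimilarity.exists_jointlySimilar_of_isUnit_mem_cone hΦcont hcomm hpos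
      hQ hunit hpure⟩
  tfae_have 2 → 3 := by
    rintro ⟨Q, hQ, hunit, hpure⟩
    obtain ⟨a, ha, haQ⟩ := JointSimilarity.exists_pos_smul_one_le hQ.1 hunit
    -- The upper bound is enlarged to `max a ‖Q‖` because `a ≤ ‖Q‖` may fail when `H` is trivial.
    refine ⟨a, max a ‖Q‖, _, Q, ha, le_max_left _ _, hQ.2 m le_rfl,
      JointSimilarity.hasBinomialSum_defect hcomm hpos hm hQ hpure, haQ,
      (JointSimilarity.le_norm_smul_one hQ.1).trans ?_⟩
    rw [Complex.coe_smul, Complex.coe_smul]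
    exact smul_le_smul_of_nonneg_right (le_max_right _ _) zero_le_one
  tfae_have 3 → 2 := by
    rintro ⟨a, b, R, S, ha, -, hR, hsum, haS, -⟩
    exact ⟨S, JointSimilarity.mem_cone_of_hasBinomialSum hΦcont hcomm hpos hm hR hsum,
      JointSimilarity.isUnit_of_smul_one_le ha haS,
      JointSimilarity.weaklyTendstoZero_of_hasBinomialSum hΦcont hcomm hpos hm hR hsum⟩
  tfae_finish
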